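/- **Proposition 2.1.** An *oriented Wicks form* is a cyclic word $w=w_1w_2\cdots w_{2e}$ (a word up to cyclic permutation) in letters $a_i$ and their inverses $a_i^{-1}$ such that 1. if a letter $x$ (some $a_i$ or $a_i^{-1}$) appears in $w$, then $x^{-1}$ appears exactly once in $w$; 2. $w$ has no cyclic factor $xx^{-1}$; 3. if $xy$ is a cyclic factor of $w$, then $y^{-1}x^{-1}$ is not a cyclic factor of $w$. Label the sides of an oriented $2e$-gon by $w$ and glue each side $x$ to the side $x^{-1}$, reversing orientation. This gives a closed oriented surface $S$, and the boundary of the polygon becomes a graph $\Gamma\subset S$ with $e$ edges and $v$ vertices, called the edges and vertices of $w$. The *genus* of $w$ is the genus $g$ of $S$, so that $2-2g=\chi(S)=v-e+1$. An oriented Wicks form of genus $g$ is *maximal* if its length $2e$ equals $6(2g-1)$. Let $V$ be a trivalent vertex of $w$, with oriented edges $a,b,c$ pointing toward $V$. Up to cyclic permutation of $w$, $V$ is *positive* if $$w=ab^{-1}\cdots bc^{-1}\cdots ca^{-1}\cdots\quad\text{or}\quad w=ac^{-1}\cdots cb^{-1}\cdots ba^{-1}\cdots,$$ and *negative* if $$w=ab^{-1}\cdots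 ca^{-1}\cdots bc^{-1}\cdots\quad\text{or}\quad w=ac^{-1}\cdots ba^{-1}\cdots cb^{-1}\cdots,$$ where the dots stand for arbitrary, possibly empty, words. Then every oriented maximal Wicks form of genus $g$ has exactly $2(g-1)$ positive and exactly $2g$ negative vertices. -/

import Mathlib

/-- A letter of the alphabet `a_i, a_i⁻¹` (`i : α`): the pair `(i, true)` is `a_i` and the pair
`(i, false)` is `a_i⁻¹`, as for the words of Mathlib's `FreeGroup α`. -/
abbrev Letter (α : Type*) := α × Bool

/-- The inverse letter. -/
def Letter.inv {α : Type*} (x : Letter α) : Letter α := (x.1, !x.2)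

namespace Wicks

variable {α : Type*}

/-- The two-letter word `x y` is a cyclic factor of the cyclic word `w`. -/
def IsFactor (w : Cycle (Letter α)) (x y : Letter α) : Prop :=
  ∃ u : List (Letter α), w = ↑(x :: y :: u)

/-- Oriented Wicks forms. Mathlib's `Cycle` is the type of lists modulo cyclic permutation. -/
structure IsOriented [DecidableEq α] (w : Cycle (Letter α)) : Prop where
  /-- if a letter appears in `w`, then its inverse appears exactly once in `w` -/
  inv_once : ∀ x ∈ w, w.toMultiset.count x.inv = 1
  /-- no cancellation -/
  no_cancel : ∀ x : Letter α, ¬ IsFactor w x x.inv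
  /-- no substitution `x y ↦ z`, `y⁻¹ x⁻¹ ↦ z⁻¹` is possible -/
  no_subst : ∀ x y : Letter α, IsFactor w x y → ¬ IsFactor w y.inv x.inv

/-- The letters of `w` label the sides of an oriented polygon, and two sides with inverse labels
are glued to each other, reversing the orientation. Since each letter occurs once in `w`, the
corners of the polygon correspond to the letters of `w`, the letter `x` standing for the corner
at the end of the side `x`. If the side `x` is followed by the side `y⁻¹`, then the end of `x` is
the start of the side `y⁻¹`, which is glued to the end of the side `y`. -/
def Glued (w : Cycle (Letter α)) (x y : {x : Letter α // x ∈ w}) : Prop :=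
  IsFactor w x.1 y.1.inv

/-- The vertices of `w`: the corners of the polygon modulo the equivalence relation generated by
the gluing of the sides. -/
def Vertex (w : Cycle (Letter α)) : Type _ := Quot (Glued w)

/-- The oriented edges (letters of `w`) that point toward the vertex `V`. -/
def star {w : Cycle (Letter α)} (V : Vertex w) : Set (Letter α) :=
  {x | ∃ h : x ∈ w, (Quot.mk (Glued w) ⟨x, h⟩ : Vertex w) = V}

/-- The (unoriented) edges of `w`: the pairs of glued sides, given by the indices `i` such that
`a_i` or `a_i⁻¹` appears in `w`. -/
def edges (w : Cycle (Letter α)) : Set α := {i | ∃ ε : Bool, (i, ε) ∈ w}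

/-- The Euler characteristic `v - e + 1` of the closed oriented surface obtained from the polygon
with boundary word `w`, which has one face. -/
noncomputable def eulerChar (w : Cycle (Letter α)) : ℤ :=
  (Nat.card (Vertex w) : ℤ) - ((edges w).ncard : ℤ) + 1

/-- The (topological) genus of `w` is `g`: the surface obtained from `w` has genus `g`, that is,
Euler characteristic `2 - 2g`. -/
def HasGenus (w : Cycle (Letter α)) (g : ℕ) : Prop := eulerChar w = 2 - 2 * (g : ℤ)

/-- Oriented maximal Wicks forms of genus `g`. The length is compared in `ℤ`. -/
structure IsOrientedMaximal [DecidableEq α] (w : Cycle (Letter α)) (g : ℕ) : Prop where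
  oriented : IsOriented w
  genus : HasGenus w g
  length_eq : (w.length : ℤ) = 6 * (2 * (g : ℤ) - 1)

/-- The vertex `V` is trivalent, and the edges pointing toward it are `a`, `b`, `c`. -/
def IsTrivalentWith {w : Cycle (Letter α)} (V : Vertex w) (a b c : Letter α) : Prop :=
  a ≠ b ∧ b ≠ c ∧ a ≠ c ∧ star V = {a, b, c}

/-- `w = a b⁻¹ … b c⁻¹ … c a⁻¹ …` or `w = a c⁻¹ … c b⁻¹ … b a⁻¹ …` as cyclic words, where
`a`, `b`, `c` are the oriented edges pointing toward `V`. -/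
def IsPositive {w : Cycle (Letter α)} (V : Vertex w) : Prop :=
  ∃ a b c : Letter α, IsTrivalentWith V a b c ∧ ∃ u₁ u₂ u₃ : List (Letter α),
    w = ↑([a, b.inv] ++ u₁ ++ [b, c.inv] ++ u₂ ++ [c, a.inv] ++ u₃) ∨
    w = ↑([a, c.inv] ++ u₁ ++ [c, b.inv] ++ u₂ ++ [b, a.inv] ++ u₃)

/-- `w = a b⁻¹ … c a⁻¹ … b c⁻¹ …` or `w = a c⁻¹ … b a⁻¹ … c b⁻¹ …` as cyclic words, where
`a`, `b`, `c` are the oriented edges pointing toward `V`. -/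
def IsNegative {w : Cycle (Letter α)} (V : Vertex w) : Prop :=
  ∃ a b c : Letter α, IsTrivalentWith V a b c ∧ ∃ u₁ u₂ u₃ : List (Letter α),
    w = ↑([a, b.inv] ++ u₁ ++ [c, a.inv] ++ u₂ ++ [b, c.inv] ++ u₃) ∨
    w = ↑([a, c.inv] ++ u₁ ++ [b, a.inv] ++ u₂ ++ [c, b.inv] ++ u₃)

end Wicks

/-! Let `ρ` send a letter to the next one in `w`, let `ι` be inversion and `σ = ι ∘ ρ`. If `x` is
followed by `y⁻¹`, then `y = σ x`, so the vertices are the orbits of `σ`. The Wicks conditions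
exclude orbits of size one and two. Maximality gives `e = 6g - 3`, `v = 4g - 2`, hence `2e = 3v`,
and every orbit has size three (`mk_eq_mk_iff_of_card`).

Number the letters by position. Around a vertex `σ` has one descent if the orbit runs in cyclic
order, which is the positive pattern, and two otherwise, which is the negative one (`card_cycLT`,
`isPositive_mk_iff`, `isNegative_mk_iff`). There are `e + 1` descents in all
(`two_mul_card_descents`). So `v₊ + 2 v₋ = 6g - 2` and `v₊ + v₋ = 4g - 2`, whence `v₋ = 2g` and `v₊
= 2g - 2`. -/

/-! ### Descents and orbits of permutations of a finite set -/

/-- For a numbering `p` of a finite set by `0, …, n - 1`, the rotation `ρ`, and a fixed-point-free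
involution `ι` such that `ι ∘ ρ` has no fixed point, the map `ι ∘ ρ` has exactly `n / 2 + 1`
descents. -/
theorem two_mul_card_descents {X : Type*} [Fintype X] (p : X → ℕ) (hp : p.Injective)
    (hlt : ∀ x, p x < Fintype.card X) (ρ : Equiv.Perm X)
    (hρ : ∀ x, p (ρ x) = (p x + 1) % Fintype.card X) (ι : X → X) (hι : ι.Involutive)
    (hne : ∀ x, ι x ≠ x) (hσ : ∀ x, ι (ρ x) ≠ x) [Nonempty X] :
    2 * (Finset.univ.filter fun x => p (ι (ρ x)) < p x).card = Fintype.card X + 2 := by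
  classical
  have hpos : 0 < Fintype.card X := Fintype.card_pos
  obtain ⟨z, hz⟩ : ∃ z, p z = 0 := by
    have hb : Function.Bijective (fun x => (⟨p x, hlt x⟩ : Fin (Fintype.card X))) := by
      rw [Fintype.bijective_iff_injective_and_card]
      exact ⟨fun x y h => hp (by simpa using h), by simp⟩
    obtain ⟨z, hz⟩ := hb.2 ⟨0, hpos⟩
    exact ⟨z, by simpa using hz⟩
  have hstep : ∀ x, p (ρ x) = p x + 1 ∨ (p x + 1 = Fintype.card X ∧ p (ρ x) = 0) := by
    intro x
    rw [hρ x]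
    rcases Nat.lt_or_ge (p x + 1) (Fintype.card X) with h | h
    · left; exact Nat.mod_eq_of_lt h
    · right
      have := hlt x
      have h' : p x + 1 = Fintype.card X := by omega
      exact ⟨h', by rw [h', Nat.mod_self]⟩
  -- Put `y = ρ x`. Away from the wrap-around `p y = p x + 1`, and `ι y ≠ x`, so `p (ι y) < p x` iff
  -- `p (ι y) < p y`. At the wrap-around `y = z` and `p x` is maximal, which always gives a descent.
  have h1 : (Finset.univ.filter fun x => p (ι (ρ x)) < p x).card =
      (insert z (Finset.univ.filter fun y => p (ι y) < p y)).card := by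
    refine Finset.card_bij (fun x _ => ρ x) ?_ (fun _ _ _ _ h => ρ.injective h) ?_
    · intro x hx
      simp only [Finset.mem_filter, Finset.mem_univ, true_and, Finset.mem_insert] at hx ⊢
      rcases hstep x with h | ⟨-, h⟩
      · right; omega
      · left; exact hp (by rw [h, hz])
    · intro y hy
      refine ⟨ρ.symm y, ?_, by simp⟩
      simp only [Finset.mem_filter, Finset.mem_univ, true_and, Finset.mem_insert] at hy ⊢
      have h1 := hstep (ρ.symm y)
      have h2 := hlt (ι y)
      have h3 : p (ι y) ≠ p (ρ.symm y) := by
        intro h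
        have := hσ (ρ.symm y)
        simp only [Equiv.apply_symm_apply] at this
        exact this (hp h)
      simp only [Equiv.apply_symm_apply] at h1 ⊢
      rcases hy with rfl | hy
      · omega
      · omega
  have h2 : z ∉ Finset.univ.filter fun y => p (ι y) < p y := by simp [hz]
  rw [h1, Finset.card_insert_of_notMem h2]
  -- The involution `ι` exchanges its descents and its ascents.
  have h3 : (Finset.univ.filter fun y => p (ι y) < p y).card =
      (Finset.univ.filter fun y => ¬ p (ι y) < p y).card := by
    refine Finset.card_bij (fun y _ => ι y) ?_ (fun _ _ _ _ h => hι.injective h) ?_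
    · intro y hy
      simp only [Finset.mem_filter, Finset.mem_univ, true_and, hι y] at hy ⊢
      omega
    · intro y hy
      refine ⟨ι y, ?_, hι y⟩
      simp only [Finset.mem_filter, Finset.mem_univ, true_and, hι y] at hy ⊢
      have : p (ι y) ≠ p y := fun h => hne y (hp h)
      omega
  have h4 := Finset.card_filter_add_card_filter_not (s := Finset.univ) (fun y => p (ι y) < p y)
  rw [Finset.card_univ] at h4
  omega

/-- If a permutation without orbits of size one or two has as many orbits as a third of the number
of elements, then all orbits have size three. -/
theorem mk_eq_mk_iff_of_card {X : Type*} [Fintype X] {r : X → X → Prop} (σ : X → X)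
    (hinj : σ.Injective) (hr : ∀ x y, r x y ↔ y = σ x) (h1 : ∀ x, σ x ≠ x)
    (h2 : ∀ x, σ (σ x) ≠ x) (hcard : Fintype.card X = 3 * Nat.card (Quot r)) (x : X) :
    σ (σ (σ x)) = x ∧ ∀ y, Quot.mk r y = Quot.mk r x ↔ y = x ∨ y = σ x ∨ y = σ (σ x) := by
  classical
  have : Finite (Quot r) := inferInstance
  let _ : Fintype (Quot r) := Fintype.ofFinite _
  have hmk : ∀ x, Quot.mk r (σ x) = Quot.mk r x := fun x => (Quot.sound ((hr x _).2 rfl)).symm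
  have hsub : ∀ x, ({x, σ x, σ (σ x)} : Finset X) ⊆
      Finset.univ.filter fun y => Quot.mk r y = Quot.mk r x := by
    intro x y hy
    simp only [Finset.mem_insert, Finset.mem_singleton] at hy
    rcases hy with rfl | rfl | rfl <;> simp [hmk]
  have h3 : ∀ x, ({x, σ x, σ (σ x)} : Finset X).card = 3 := by
    intro x
    rw [Finset.card_eq_three]
    exact ⟨x, σ x, σ (σ x), (h1 x).symm, (h2 x).symm, (h1 _).symm, rfl⟩
  have hge : ∀ V : Quot r, 3 ≤ (Finset.univ.filter fun y => Quot.mk r y = V).card := by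
    intro V
    induction V using Quot.inductionOn with
    | h x => exact (h3 x).symm.le.trans (Finset.card_le_card (hsub x))
  -- Each class has at least three elements, and three on average by `hcard`, so exactly three.
  have hsum : ∑ V : Quot r, 3 =
      ∑ V : Quot r, (Finset.univ.filter fun y => Quot.mk r y = V).card := by
    rw [← Finset.card_eq_sum_card_fiberwise (f := Quot.mk r) (s := Finset.univ)
        (fun _ _ => Finset.mem_coe.2 (Finset.mem_univ _)),
      Finset.card_univ, hcard, Nat.card_eq_fintype_card]
    simp [mul_comm]
  have heq := (Finset.sum_eq_sum_iff_of_le fun V _ => hge V).1 hsum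
  have hset : ∀ x, ({x, σ x, σ (σ x)} : Finset X) =
      Finset.univ.filter fun y => Quot.mk r y = Quot.mk r x := fun x =>
    Finset.eq_of_subset_of_card_le (hsub x) (by rw [h3, ← heq _ (Finset.mem_univ _)])
  have hiff : ∀ y, Quot.mk r y = Quot.mk r x ↔ y = x ∨ y = σ x ∨ y = σ (σ x) := by
    intro y
    have := congrArg (y ∈ ·) (hset x)
    simpa using this.symm
  refine ⟨?_, hiff⟩
  rcases (hiff (σ (σ (σ x)))).1 (by simp [hmk]) with h | h | h
  · exact h
  · exact absurd (hinj h) (h2 x)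
  · exact absurd h (h1 _)

/-- Counting elements of the fibres of a quotient whose fibres have size three. -/
theorem card_filter_mk {X : Type*} [Fintype X] {r : X → X → Prop} (σ : X → X)
    (h1 : ∀ x, σ x ≠ x) (h2 : ∀ x, σ (σ x) ≠ x)
    (hmk : ∀ x y, Quot.mk r y = Quot.mk r x ↔ y = x ∨ y = σ x ∨ y = σ (σ x))
    (P : Set (Quot r)) : Nat.card {x // Quot.mk r x ∈ P} = 3 * P.ncard := by
  classical
  have : Finite (Quot r) := inferInstance
  let _ : Fintype (Quot r) := Fintype.ofFinite _
  rw [Set.ncard_eq_toFinset_card' P, Nat.card_eq_fintype_card, Fintype.card_subtype,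
    Finset.card_eq_sum_card_fiberwise (f := fun x => Quot.mk r x) (t := P.toFinset)
      (by intro x hx; simpa using hx), Finset.sum_const_nat (m := 3), mul_comm]
  intro V hV
  rw [Set.mem_toFinset] at hV
  induction V using Quot.inductionOn with
  | h x =>
    rw [Finset.card_eq_three]
    refine ⟨x, σ x, σ (σ x), (h1 x).symm, (h2 x).symm, (h1 _).symm, ?_⟩
    ext y
    simp only [Finset.mem_filter, Finset.mem_univ, true_and, Finset.mem_insert,
      Finset.mem_singleton, ← hmk]
    exact ⟨fun h => h.2, fun h => ⟨h ▸ hV, h⟩⟩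

/-! ### Cyclic order of positions -/

/-- The cyclic order of three natural numbers. -/
def CycLT (i j k : ℕ) : Prop := (i < j ∧ j < k) ∨ (j < k ∧ k < i) ∨ (k < i ∧ i < j)

/-- If all orbits of `σ` have size three, the number of descents of `σ` determines the number of
elements whose orbit is traversed in the cyclic order. -/
theorem card_cycLT {X : Type*} [Fintype X] (p : X → ℕ) (hp : p.Injective) (σ : X → X)
    (h1 : ∀ x, σ x ≠ x) (h2 : ∀ x, σ (σ x) ≠ x) (h3 : ∀ x, σ (σ (σ x)) = x) :
    Nat.card {x // CycLT (p x) (p (σ x)) (p (σ (σ x)))} +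
      3 * Nat.card {x // p (σ x) < p x} = 2 * Fintype.card X := by
  classical
  let e : Equiv.Perm X := ⟨σ, fun x => σ (σ x), h3, h3⟩
  simp only [Nat.card_eq_fintype_card, Fintype.card_subtype, Finset.card_filter]
  have hA : ∑ x, (if p (σ (σ x)) < p (σ x) then 1 else 0) =
      ∑ x, (if p (σ x) < p x then 1 else 0) :=
    Equiv.sum_comp e fun x => if p (σ x) < p x then 1 else 0
  have hB : ∑ x, (if p x < p (σ (σ x)) then 1 else 0) =
      ∑ x, (if p (σ (σ x)) < p (σ x) then 1 else 0) := by
    rw [← Equiv.sum_comp e fun x => if p (σ (σ x)) < p (σ x) then 1 else 0]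
    exact Finset.sum_congr rfl fun x _ => by simp [e, h3]
  -- Three distinct numbers read around a circle have one descent in cyclic order and two otherwise.
  -- Summed over `x`, the three descent terms agree, by reindexing along `σ`.
  have key : ∀ x, (if CycLT (p x) (p (σ x)) (p (σ (σ x))) then 1 else 0) +
      ((if p (σ x) < p x then 1 else 0) + (if p (σ (σ x)) < p (σ x) then 1 else 0) +
        (if p x < p (σ (σ x)) then 1 else 0)) = 2 := by
    intro x
    have := hp.ne (h1 x)
    have := hp.ne (h2 x)
    have := hp.ne (h1 (σ x))
    unfold CycLT
    split_ifs <;> omega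
  have := Finset.sum_congr rfl fun x (_ : x ∈ Finset.univ) => key x
  simp only [Finset.sum_add_distrib, Finset.sum_const, Finset.card_univ, smul_eq_mul] at this
  omega

theorem cycLT_rotate {i j k : ℕ} (h : CycLT i j k) : CycLT j k i := by
  unfold CycLT at *; omega

/-- The swap shifts positions in `s` up by the length of `t` and positions in `t` down by the length
of `s`: a rotation of the circle of positions. -/
theorem cycLT_idxOf_append_comm {β : Type*} [BEq β] [LawfulBEq β] {s t : List β} {a b c : β}
    (hn : (s ++ t).Nodup) (ha : a ∈ s ++ t) (hb : b ∈ s ++ t) (hc : c ∈ s ++ t)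
    (h : CycLT ((s ++ t).idxOf a) ((s ++ t).idxOf b) ((s ++ t).idxOf c)) :
    CycLT ((t ++ s).idxOf a) ((t ++ s).idxOf b) ((t ++ s).idxOf c) := by
  have key : ∀ x ∈ s ++ t,
      ((s ++ t).idxOf x < s.length ∧ (t ++ s).idxOf x = (s ++ t).idxOf x + t.length) ∨
      (s.length ≤ (s ++ t).idxOf x ∧ (s ++ t).idxOf x < s.length + t.length ∧
        (t ++ s).idxOf x + s.length = (s ++ t).idxOf x) := by
    intro x hx
    have hdis := List.disjoint_of_nodup_append hn
    rcases List.mem_append.1 hx with h | h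
    · have h' : x ∉ t := fun h' => hdis h h'
      have := List.idxOf_lt_length_of_mem h
      rw [List.idxOf_append_of_mem h, List.idxOf_append_of_notMem h']
      omega
    · have h' : x ∉ s := fun h' => hdis h' h
      have := List.idxOf_lt_length_of_mem h
      rw [List.idxOf_append_of_mem h, List.idxOf_append_of_notMem h']
      omega
  have h1 := key a ha
  have h2 := key b hb
  have h3 := key c hc
  unfold CycLT at *
  omega

/-- The cyclic order of the positions of three elements of a list is invariant under rotation. -/
theorem cycLT_idxOf_of_isRotated {β : Type*} [BEq β] [LawfulBEq β] {l l' : List β} (hr : l ~r l')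
    {a b c : β} (hn : l.Nodup) (ha : a ∈ l) (hb : b ∈ l) (hc : c ∈ l)
    (h : CycLT (l.idxOf a) (l.idxOf b) (l.idxOf c)) :
    CycLT (l'.idxOf a) (l'.idxOf b) (l'.idxOf c) := by
  obtain ⟨k, rfl⟩ := hr
  rw [List.rotate_eq_drop_append_take_mod]
  have hl := List.take_append_drop (k % l.length) l
  apply cycLT_idxOf_append_comm <;> rw [hl] <;> assumption

theorem idxOf_next {β : Type*} [DecidableEq β] [BEq β] [LawfulBEq β] {l : List β} (hn : l.Nodup)
    {x : β} (hx : x ∈ l) : l.idxOf (l.next x hx) = (l.idxOf x + 1) % l.length := by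
  obtain ⟨i, hi, rfl⟩ := List.getElem_of_mem hx
  rw [List.next_getElem l hn i hi, hn.idxOf_getElem, hn.idxOf_getElem]

theorem notMem_of_nodup_append {β : Type*} {s u t : List β} {x : β} (hn : (s ++ (u ++ t)).Nodup)
    (hx : x ∈ t) : x ∉ u := fun h =>
  List.disjoint_of_nodup_append hn.of_append_right h hx

/-! ### Factors of cyclic words -/

namespace Wicks

variable {α : Type*}

theorem inv_inv' (x : Letter α) : x.inv.inv = x := by simp [Letter.inv]

theorem inv_ne_self (x : Letter α) : x.inv ≠ x := by
  intro h
  have := congrArg Prod.snd h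
  simp [Letter.inv] at this

theorem coe_append_comm {β : Type*} (s t : List β) : (↑(s ++ t) : Cycle β) = ↑(t ++ s) :=
  Cycle.coe_eq_coe.2 List.isRotated_append

theorem IsFactor.mem {w : Cycle (Letter α)} {x y : Letter α} (h : IsFactor w x y) : x ∈ w := by
  obtain ⟨u, rfl⟩ := h
  simp

/-- The length bound is needed: in a one-letter cycle `next` fixes the letter, but there is no
two-letter factor. -/
theorem isFactor_iff_next [DecidableEq α] {w : Cycle (Letter α)} (hn : w.Nodup)
    (hlen : 2 ≤ w.length) {x y : Letter α} (hx : x ∈ w) :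
    IsFactor w x y ↔ w.next hn x hx = y := by
  constructor
  · rintro ⟨u, rfl⟩
    exact List.nextOr_self_cons_cons _ _ _ _
  · intro h
    have : ∃ z, IsFactor w x z := by
      induction w using Quotient.inductionOn' with
      | h l =>
        obtain ⟨s, t, rfl⟩ := List.append_of_mem (Cycle.mem_coe_iff.1 hx)
        have hc : (↑(s ++ x :: t) : Cycle (Letter α)) = ↑(x :: (t ++ s)) := coe_append_comm _ _
        rcases hts : t ++ s with _ | ⟨y, u⟩
        · rw [List.append_eq_nil_iff] at hts
          rw [hts.1, hts.2] at hlen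
          exact absurd hlen (by simp)
        · rw [hts] at hc
          exact ⟨y, u, hc⟩
    obtain ⟨z, u, rfl⟩ := this
    have hz : Cycle.next _ hn x hx = z := List.nextOr_self_cons_cons _ _ _ _
    exact ⟨u, by rw [← h, hz]⟩

theorem IsFactor.unique {w : Cycle (Letter α)} (hn : w.Nodup)
    {x y z : Letter α} (h1 : IsFactor w x y) (h2 : IsFactor w x z) : y = z := by
  classical
  have hlen : 2 ≤ w.length := by
    obtain ⟨u, rfl⟩ := h1
    simp
  rw [← (isFactor_iff_next hn hlen h1.mem).1 h1, (isFactor_iff_next hn hlen h1.mem).1 h2]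

theorem not_isFactor_self {w : Cycle (Letter α)} (hn : w.Nodup) (x : Letter α) :
    ¬ IsFactor w x x := by
  rintro ⟨u, rfl⟩
  rw [Cycle.nodup_coe_iff] at hn
  simp at hn

/-- The order in which three disjoint two-letter factors of a cyclic word without repeated letters
occur is the cyclic order of the positions of their first letters. -/
theorem cycLT_iff_exists_eq [BEq (Letter α)] [LawfulBEq (Letter α)] {l : List (Letter α)}
    (hn : l.Nodup)
    {a b c a' b' c' : Letter α} (ha : IsFactor ↑l a a') (hb : IsFactor ↑l b b')
    (hc : IsFactor ↑l c c') (hab : a ≠ b) (hac : a ≠ c) (hbc : b ≠ c)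
    (hba' : b ≠ a') (hca' : c ≠ a') (hcb' : c ≠ b') (hac' : a ≠ c') :
    CycLT (l.idxOf a) (l.idxOf b) (l.idxOf c) ↔
      ∃ u₁ u₂ u₃ : List (Letter α),
        (↑l : Cycle (Letter α)) = ↑([a, a'] ++ u₁ ++ [b, b'] ++ u₂ ++ [c, c'] ++ u₃) := by
  have hma := Cycle.mem_coe_iff.1 ha.mem
  have hmb := Cycle.mem_coe_iff.1 hb.mem
  have hmc := Cycle.mem_coe_iff.1 hc.mem
  constructor
  · intro h
    obtain ⟨u, hu⟩ := id ha
    have hr := Cycle.coe_eq_coe.1 hu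
    have hn' := hr.nodup_iff.1 hn
    -- After rotation `a` has position 0, so the cyclic order says that `b` precedes `c`.
    replace h := cycLT_idxOf_of_isRotated hr hn hma hmb hmc h
    have hbu : b ∈ u := by
      have := hr.mem_iff.1 hmb
      simpa [hab.symm, hba'] using this
    obtain ⟨s, t, rfl⟩ := List.append_of_mem hbu
    have hct : c ∈ t := by
      have := hr.mem_iff.1 hmc
      simp only [List.mem_cons, List.mem_append, hac.symm, hca', hbc.symm, false_or] at this
      refine this.resolve_left fun hcs => ?_
      have hbs : b ∉ s := by
        intro hbs
        simp only [List.nodup_cons, List.nodup_append] at hn'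
        exact hn'.2.2.2.2 b hbs b (by simp) rfl
      have := List.idxOf_lt_length_of_mem hcs
      simp only [List.idxOf_cons_self, List.idxOf_cons_ne _ hab, List.idxOf_cons_ne _ hac,
        List.idxOf_cons_ne _ hba'.symm, List.idxOf_cons_ne _ hca'.symm,
        List.idxOf_append_of_mem hcs, List.idxOf_append_of_notMem hbs, CycLT] at h
      omega
    obtain ⟨s₂, t₂, rfl⟩ := List.append_of_mem hct
    have hnw : Cycle.Nodup (↑l : Cycle (Letter α)) := hn
    have e1 : (↑l : Cycle (Letter α)) = ↑((b :: (s₂ ++ c :: t₂)) ++ (a :: a' :: s)) := by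
      rw [hu, coe_append_comm]; simp
    have e2 : (↑l : Cycle (Letter α)) =
        ↑((c :: t₂) ++ (a :: a' :: (s ++ b :: s₂))) := by
      rw [hu, coe_append_comm]; simp
    -- An empty gap would make `c` the successor of `b`, or `a` the successor of `c`, which the
    -- hypotheses exclude. So the gaps begin with `b'` and `c'`.
    rcases s₂ with _ | ⟨y, s₂⟩
    · exact absurd (hb.unique hnw ⟨_, e1⟩) hcb'.symm
    rcases t₂ with _ | ⟨z, t₂⟩
    · exact absurd (hc.unique hnw ⟨_, e2⟩) hac'.symm
    obtain rfl := hb.unique hnw ⟨_, e1⟩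
    obtain rfl := hc.unique hnw ⟨_, e2⟩
    exact ⟨s, s₂, t₂, by rw [hu]; simp⟩
  · rintro ⟨u₁, u₂, u₃, hu⟩
    have hr := Cycle.coe_eq_coe.1 hu
    have hn' := hr.nodup_iff.1 hn
    refine cycLT_idxOf_of_isRotated hr.symm hn' (hr.mem_iff.1 hma) (hr.mem_iff.1 hmb)
      (hr.mem_iff.1 hmc) ?_
    have hb1 : b ∉ u₁ := notMem_of_nodup_append (s := [a, a'])
      (t := [b, b'] ++ u₂ ++ [c, c'] ++ u₃) (by simpa only [List.append_assoc] using hn') (by simp)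
    have hc1 : c ∉ u₁ := notMem_of_nodup_append (s := [a, a'])
      (t := [b, b'] ++ u₂ ++ [c, c'] ++ u₃) (by simpa only [List.append_assoc] using hn') (by simp)
    have hc2 : c ∉ u₂ := notMem_of_nodup_append (s := [a, a'] ++ u₁ ++ [b, b'])
      (t := [c, c'] ++ u₃) (by simpa only [List.append_assoc] using hn') (by simp)
    simp only [List.cons_append, List.nil_append, List.append_assoc, List.idxOf_cons_self,
      List.idxOf_cons_ne _ hab, List.idxOf_cons_ne _ hac, List.idxOf_cons_ne _ hba'.symm,
      List.idxOf_cons_ne _ hca'.symm, List.idxOf_append_of_notMem hb1,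
      List.idxOf_append_of_notMem hc1, List.idxOf_cons_ne _ hbc, List.idxOf_cons_ne _ hcb'.symm,
      List.idxOf_append_of_notMem hc2, CycLT]
    omega

theorem isFactor_of_eq_coe_append {w : Cycle (Letter α)} {s t : List (Letter α)}
    {x y : Letter α} (h : w = ↑(s ++ [x, y] ++ t)) : IsFactor w x y :=
  ⟨t ++ s, by rw [h, List.append_assoc, coe_append_comm]; simp⟩

theorem isTrivalentWith_mk {l : List (Letter α)}
    {σ : {x : Letter α // x ∈ (↑l : Cycle (Letter α))} →
      {x : Letter α // x ∈ (↑l : Cycle (Letter α))}}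
    (h1 : ∀ x, σ x ≠ x) (h2 : ∀ x, σ (σ x) ≠ x)
    (hmk : ∀ x y, (Quot.mk _ y : Vertex (↑l : Cycle (Letter α))) = Quot.mk _ x ↔
      y = x ∨ y = σ x ∨ y = σ (σ x))
    (x : {x : Letter α // x ∈ (↑l : Cycle (Letter α))}) :
    IsTrivalentWith (Quot.mk _ x : Vertex (↑l : Cycle (Letter α)))
      x.1 (σ x).1 (σ (σ x)).1 := by
  refine ⟨fun h => h1 x (Subtype.ext h.symm), fun h => h1 _ (Subtype.ext h.symm),
    fun h => h2 x (Subtype.ext h.symm), ?_⟩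
  ext y
  constructor
  · rintro ⟨hy, h⟩
    rcases (hmk x ⟨y, hy⟩).1 h with h | h | h <;> simp [← h]
  · rintro (rfl | rfl | rfl)
    · exact ⟨x.2, rfl⟩
    · exact ⟨(σ x).2, (hmk x _).2 (Or.inr (Or.inl rfl))⟩
    · exact ⟨(σ (σ x)).2, (hmk x _).2 (Or.inr (Or.inr rfl))⟩

/-! ### Positive and negative vertices in terms of `σ` -/

section Orbit

variable {l : List (Letter α)} [BEq (Letter α)] [LawfulBEq (Letter α)]
  {σ : {x : Letter α // x ∈ (↑l : Cycle (Letter α))} →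
    {x : Letter α // x ∈ (↑l : Cycle (Letter α))}}

/-- The corners at the vertex give the factors `a b⁻¹`, `b c⁻¹`, `c a⁻¹`. They do not overlap, since
no letter follows itself or equals its inverse, so only their cyclic order remains to be decided. -/
theorem cycLT_orbit_iff (hn : l.Nodup)
    (hσ : ∀ x y, IsFactor ↑l x.1 y.1.inv ↔ y = σ x) (h1 : ∀ x, σ x ≠ x)
    (h3 : ∀ x, σ (σ (σ x)) = x)
    {a b c : {x : Letter α // x ∈ (↑l : Cycle (Letter α))}} (hab : b = σ a) (hbc : c = σ b) :
    (CycLT (l.idxOf a.1) (l.idxOf b.1) (l.idxOf c.1) ↔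
      ∃ u₁ u₂ u₃ : List (Letter α), (↑l : Cycle (Letter α)) =
        ↑([a.1, b.1.inv] ++ u₁ ++ [b.1, c.1.inv] ++ u₂ ++ [c.1, a.1.inv] ++ u₃)) ∧
    (CycLT (l.idxOf a.1) (l.idxOf c.1) (l.idxOf b.1) ↔
      ∃ u₁ u₂ u₃ : List (Letter α), (↑l : Cycle (Letter α)) =
        ↑([a.1, b.1.inv] ++ u₁ ++ [c.1, a.1.inv] ++ u₂ ++ [b.1, c.1.inv] ++ u₃)) := by
  have hca : a = σ c := by rw [hbc, hab, h3]
  have hnw : Cycle.Nodup (↑l : Cycle (Letter α)) := hn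
  have ne : ∀ x y : {x : Letter α // x ∈ (↑l : Cycle (Letter α))}, y = σ x →
      x.1 ≠ y.1 ∧ x.1 ≠ y.1.inv ∧ y.1 ≠ x.1.inv := by
    intro x y hxy
    have hf := (hσ x y).2 hxy
    refine ⟨fun h => h1 x (hxy ▸ (Subtype.ext h).symm), fun h => ?_, fun h => ?_⟩
    · rw [← h] at hf
      exact not_isFactor_self hnw _ hf
    · rw [h, inv_inv'] at hf
      exact not_isFactor_self hnw _ hf
  obtain ⟨n1, n2, n3⟩ := ne a b hab
  obtain ⟨n4, n5, n6⟩ := ne b c hbc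
  obtain ⟨n7, n8, n9⟩ := ne c a hca
  have fa := (hσ a b).2 hab
  have fb := (hσ b c).2 hbc
  have fc := (hσ c a).2 hca
  exact ⟨cycLT_iff_exists_eq hn fa fb fc n1 n7.symm n4 (inv_ne_self _).symm n6
      (inv_ne_self _).symm (inv_ne_self _).symm,
    cycLT_iff_exists_eq hn fa fc fb n7.symm n1 n4.symm n6 (inv_ne_self _).symm n3 n9⟩

/-- The two patterns differ by exchanging `b` and `c`, so one suffices. It forces `b = σ a` and `c =
σ b`; as `a` may be any of the three orbit points, the order is rotated back to start at `x`. -/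
theorem isPositive_mk_iff (hn : l.Nodup)
    (hσ : ∀ x y, IsFactor ↑l x.1 y.1.inv ↔ y = σ x) (h1 : ∀ x, σ x ≠ x)
    (h2 : ∀ x, σ (σ x) ≠ x) (h3 : ∀ x, σ (σ (σ x)) = x)
    (hmk : ∀ x y, (Quot.mk _ y : Vertex (↑l : Cycle (Letter α))) = Quot.mk _ x ↔
      y = x ∨ y = σ x ∨ y = σ (σ x))
    (x : {x : Letter α // x ∈ (↑l : Cycle (Letter α))}) :
    IsPositive (Quot.mk _ x : Vertex (↑l : Cycle (Letter α))) ↔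
      CycLT (l.idxOf x.1) (l.idxOf (σ x).1) (l.idxOf (σ (σ x)).1) := by
  constructor
  · have key : ∀ a b c, star (Quot.mk _ x : Vertex (↑l : Cycle (Letter α))) = {a, b, c} →
        ∀ u₁ u₂ u₃ : List (Letter α), (↑l : Cycle (Letter α)) =
          ↑([a, b.inv] ++ u₁ ++ [b, c.inv] ++ u₂ ++ [c, a.inv] ++ u₃) →
        CycLT (l.idxOf x.1) (l.idxOf (σ x).1) (l.idxOf (σ (σ x)).1) := by
      intro a b c hs u₁ u₂ u₃ hu
      obtain ⟨ha, hax⟩ : a ∈ star (Quot.mk _ x : Vertex (↑l : Cycle (Letter α))) := by simp [hs]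
      obtain ⟨hb, -⟩ : b ∈ star (Quot.mk _ x : Vertex (↑l : Cycle (Letter α))) := by simp [hs]
      obtain ⟨hc, -⟩ : c ∈ star (Quot.mk _ x : Vertex (↑l : Cycle (Letter α))) := by simp [hs]
      clear hs
      lift a to {x : Letter α // x ∈ (↑l : Cycle (Letter α))} using ha
      lift b to {x : Letter α // x ∈ (↑l : Cycle (Letter α))} using hb
      lift c to {x : Letter α // x ∈ (↑l : Cycle (Letter α))} using hc
      have hab := (hσ a b).1 (isFactor_of_eq_coe_append (s := [])
        (t := u₁ ++ [b.1, c.1.inv] ++ u₂ ++ [c.1, a.1.inv] ++ u₃) (hu.trans (by simp)))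
      have hbc := (hσ b c).1 (isFactor_of_eq_coe_append (s := [a.1, b.1.inv] ++ u₁)
        (t := u₂ ++ [c.1, a.1.inv] ++ u₃) (hu.trans (by simp)))
      have h := (cycLT_orbit_iff hn hσ h1 h3 hab hbc).1.2 ⟨u₁, u₂, u₃, hu⟩
      rw [hbc, hab] at h
      rcases (hmk x a).1 hax with e | e | e <;> simp only [e, h3] at h
      · exact h
      · exact cycLT_rotate (cycLT_rotate h)
      · exact cycLT_rotate h
    rintro ⟨a, b, c, ⟨-, -, -, hs⟩, u₁, u₂, u₃, hu | hu⟩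
    · exact key a b c hs u₁ u₂ u₃ hu
    · exact key a c b (by rw [hs, Set.pair_comm]) u₁ u₂ u₃ hu
  · intro h
    obtain ⟨u₁, u₂, u₃, hu⟩ := (cycLT_orbit_iff hn hσ h1 h3 rfl rfl).1.1 h
    exact ⟨_, _, _, isTrivalentWith_mk h1 h2 hmk x, u₁, u₂, u₃, Or.inl hu⟩

/-- Here too `b = σ a` and `c = σ b`, but the corners occur in the order `a`, `c`, `b`. -/
theorem isNegative_mk_iff (hn : l.Nodup)
    (hσ : ∀ x y, IsFactor ↑l x.1 y.1.inv ↔ y = σ x) (h1 : ∀ x, σ x ≠ x)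
    (h2 : ∀ x, σ (σ x) ≠ x) (h3 : ∀ x, σ (σ (σ x)) = x)
    (hmk : ∀ x y, (Quot.mk _ y : Vertex (↑l : Cycle (Letter α))) = Quot.mk _ x ↔
      y = x ∨ y = σ x ∨ y = σ (σ x))
    (x : {x : Letter α // x ∈ (↑l : Cycle (Letter α))}) :
    IsNegative (Quot.mk _ x : Vertex (↑l : Cycle (Letter α))) ↔
      CycLT (l.idxOf x.1) (l.idxOf (σ (σ x)).1) (l.idxOf (σ x).1) := by
  constructor
  · have key : ∀ a b c, star (Quot.mk _ x : Vertex (↑l : Cycle (Letter α))) = {a, b, c} →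
        ∀ u₁ u₂ u₃ : List (Letter α), (↑l : Cycle (Letter α)) =
          ↑([a, b.inv] ++ u₁ ++ [c, a.inv] ++ u₂ ++ [b, c.inv] ++ u₃) →
        CycLT (l.idxOf x.1) (l.idxOf (σ (σ x)).1) (l.idxOf (σ x).1) := by
      intro a b c hs u₁ u₂ u₃ hu
      obtain ⟨ha, hax⟩ : a ∈ star (Quot.mk _ x : Vertex (↑l : Cycle (Letter α))) := by simp [hs]
      obtain ⟨hb, -⟩ : b ∈ star (Quot.mk _ x : Vertex (↑l : Cycle (Letter α))) := by simp [hs]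
      obtain ⟨hc, -⟩ : c ∈ star (Quot.mk _ x : Vertex (↑l : Cycle (Letter α))) := by simp [hs]
      clear hs
      lift a to {x : Letter α // x ∈ (↑l : Cycle (Letter α))} using ha
      lift b to {x : Letter α // x ∈ (↑l : Cycle (Letter α))} using hb
      lift c to {x : Letter α // x ∈ (↑l : Cycle (Letter α))} using hc
      have hab := (hσ a b).1 (isFactor_of_eq_coe_append (s := [])
        (t := u₁ ++ [c.1, a.1.inv] ++ u₂ ++ [b.1, c.1.inv] ++ u₃) (hu.trans (by simp)))
      have hbc := (hσ b c).1 (isFactor_of_eq_coe_append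
        (s := [a.1, b.1.inv] ++ u₁ ++ [c.1, a.1.inv] ++ u₂)
        (t := u₃) (hu.trans (by simp)))
      have h := (cycLT_orbit_iff hn hσ h1 h3 hab hbc).2.2 ⟨u₁, u₂, u₃, hu⟩
      rw [hbc, hab] at h
      rcases (hmk x a).1 hax with e | e | e <;> simp only [e, h3] at h
      · exact h
      · exact cycLT_rotate h
      · exact cycLT_rotate (cycLT_rotate h)
    rintro ⟨a, b, c, ⟨-, -, -, hs⟩, u₁, u₂, u₃, hu | hu⟩
    · exact key a b c hs u₁ u₂ u₃ hu
    · exact key a c b (by rw [hs, Set.pair_comm]) u₁ u₂ u₃ hu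
  · intro h
    obtain ⟨u₁, u₂, u₃, hu⟩ := (cycLT_orbit_iff hn hσ h1 h3 rfl rfl).2.1 h
    exact ⟨_, _, _, isTrivalentWith_mk h1 h2 hmk x, u₁, u₂, u₃, Or.inl hu⟩

end Orbit

end Wicks

/-! ### Letters of a Wicks form and the final count -/

theorem Wicks.IsOriented.inv_mem {α : Type*} [DecidableEq α] {w : Cycle (Letter α)}
    (hw : Wicks.IsOriented w) {x : Letter α} (hx : x ∈ w) : x.inv ∈ w := by
  have h := hw.inv_once x hx
  induction w using Quotient.inductionOn' with
  | h l =>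
    exact Multiset.count_pos.1 (h ▸ one_pos : 0 < Multiset.count x.inv (l : Multiset (Letter α)))

theorem Wicks.IsOriented.nodup {α : Type*} [DecidableEq α] {w : Cycle (Letter α)}
    (hw : Wicks.IsOriented w) : w.Nodup := by
  have h : ∀ x ∈ w, w.toMultiset.count x = 1 := fun x hx => by
    have := hw.inv_once _ (hw.inv_mem hx)
    rwa [Wicks.inv_inv'] at this
  clear hw
  induction w using Quotient.inductionOn' with
  | h l =>
    change List.Nodup l
    rw [← Multiset.coe_nodup, Multiset.nodup_iff_count_le_one]
    intro x
    by_cases hx : x ∈ l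
    · exact (h x hx).le
    · rw [Multiset.count_eq_zero_of_notMem (by simpa using hx)]
      exact zero_le_one

/-- The number of letters of an oriented Wicks form is twice the number of its edges. -/
theorem Wicks.IsOriented.card_eq_two_mul_ncard_edges {α : Type*} [DecidableEq α]
    {w : Cycle (Letter α)} (hw : Wicks.IsOriented w) :
    Nat.card {x // x ∈ w} = 2 * (Wicks.edges w).ncard := by
  have : {x | x ∈ w} = Wicks.edges w ×ˢ (Set.univ : Set Bool) := by
    ext ⟨i, ε⟩
    simp only [Set.mem_ofPred_eq, Set.mem_prod, Set.mem_univ, and_true, Wicks.edges]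
    refine ⟨fun h => ⟨ε, h⟩, ?_⟩
    rintro ⟨δ, h⟩
    have h' := hw.inv_mem h
    cases ε <;> cases δ <;> simpa [Letter.inv] using ‹_›
  change Nat.card {x | x ∈ w} = _
  rw [Nat.card_coe_set_eq, this, Set.ncard_prod, Set.ncard_univ, Nat.card_eq_fintype_card,
    Fintype.card_bool, mul_comm]

theorem proposition2p1 {α : Type*} [DecidableEq α] (w : Cycle (Letter α)) (g : ℕ)
    (hw : Wicks.IsOrientedMaximal w g) :
    ({V : Wicks.Vertex w | Wicks.IsPositive V}.ncard : ℤ) = 2 * ((g : ℤ) - 1) ∧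
      {V : Wicks.Vertex w | Wicks.IsNegative V}.ncard = 2 * g := by
  obtain ⟨l, rfl⟩ : ∃ l : List (Letter α), w = ↑l := ⟨_, (Quotient.out_eq' w).symm⟩
  obtain ⟨ho, hg, hlen⟩ := hw
  have hn := ho.nodup
  have hedge := ho.card_eq_two_mul_ncard_edges
  -- A length is nonnegative, so `6 * (2g - 1)` forces `g ≥ 1` and length at least 6.
  have hlen2 : 2 ≤ (↑l : Cycle (Letter α)).length := by omega
  let ρ : Equiv.Perm {x // x ∈ (↑l : Cycle (Letter α))} :=
    { toFun x := ⟨Cycle.next ↑l hn x.1 x.2, Cycle.next_mem ↑l hn x.1 x.2⟩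
      invFun x := ⟨Cycle.prev ↑l hn x.1 x.2, Cycle.prev_mem ↑l hn x.1 x.2⟩
      left_inv x := Subtype.ext (Cycle.prev_next ↑l hn x.1 x.2)
      right_inv x := Subtype.ext (Cycle.next_prev ↑l hn x.1 x.2) }
  let ι : {x // x ∈ (↑l : Cycle (Letter α))} → {x // x ∈ (↑l : Cycle (Letter α))} :=
    fun x => ⟨x.1.inv, ho.inv_mem x.2⟩
  have hι : ι.Involutive := fun x => Subtype.ext (Wicks.inv_inv' _)
  have hσ : ∀ x y : {x // x ∈ (↑l : Cycle (Letter α))},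
      Wicks.IsFactor ↑l x.1 y.1.inv ↔ y = ι (ρ x) := by
    intro x y
    rw [Wicks.isFactor_iff_next hn hlen2 x.2, ← hι.eq_iff, Subtype.ext_iff, eq_comm]
    exact Iff.rfl
  have h1 : ∀ x, ι (ρ x) ≠ x := fun x h => ho.no_cancel _ ((hσ x x).2 h.symm)
  -- With `y = σ x` and `x = σ y`, both `x y⁻¹` and its inverse `y x⁻¹` would be factors.
  have h2 : ∀ x, ι (ρ (ι (ρ x))) ≠ x := fun x h => by
    have hb := (hσ (ι (ρ x)) x).2 h.symm
    refine ho.no_subst _ _ ((hσ x _).2 rfl) ?_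
    rwa [Wicks.inv_inv']
  let _ : Fintype {x // x ∈ (↑l : Cycle (Letter α))} :=
    Fintype.subtype l.toFinset fun x => List.mem_toFinset
  have hnl : l.Nodup := hn
  have hcard : Fintype.card {x // x ∈ (↑l : Cycle (Letter α))} = l.length :=
    (Fintype.subtype_card _ _).trans (List.toFinset_card_of_nodup hnl)
  have hll : (l.length : ℤ) = 6 * (2 * (g : ℤ) - 1) := hlen
  rw [Nat.card_eq_fintype_card, hcard] at hedge
  have hv : Fintype.card {x // x ∈ (↑l : Cycle (Letter α))} =
      3 * Nat.card (Wicks.Vertex (↑l : Cycle (Letter α))) := by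
    unfold Wicks.HasGenus Wicks.eulerChar at hg
    omega
  have horb := mk_eq_mk_iff_of_card (r := Wicks.Glued (↑l : Cycle (Letter α))) (fun x => ι (ρ x))
    (fun x y h => ρ.injective (hι.injective h)) hσ h1 h2 hv
  have h3 := fun x => (horb x).1
  have hmk := fun x => (horb x).2
  have hp : Function.Injective
      fun x : {x // x ∈ (↑l : Cycle (Letter α))} => l.idxOf x.1 :=
    fun x y h => Subtype.ext ((List.idxOf_inj (Cycle.mem_coe_iff.1 x.2)).1 h)
  have : Nonempty {x // x ∈ (↑l : Cycle (Letter α))} := by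
    rw [← Fintype.card_pos_iff]
    omega
  have hdesc := two_mul_card_descents (fun x => l.idxOf x.1) hp
    (fun x => hcard ▸ List.idxOf_lt_length_of_mem (Cycle.mem_coe_iff.1 x.2)) ρ
    (fun x => by
      rw [hcard]
      exact idxOf_next hnl (Cycle.mem_coe_iff.1 x.2)) ι hι
    (fun x h => Wicks.inv_ne_self _ (congrArg Subtype.val h)) h1
  have hcyc := card_cycLT (fun x => l.idxOf x.1) hp (fun x => ι (ρ x)) h1 h2 h3
  have hpos := Wicks.isPositive_mk_iff hnl hσ h1 h2 h3 hmk
  have hneg := Wicks.isNegative_mk_iff hnl hσ h1 h2 h3 hmk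
  have hP := card_filter_mk (r := Wicks.Glued (↑l : Cycle (Letter α))) (fun x => ι (ρ x)) h1 h2 hmk
    {V : Wicks.Vertex (↑l : Cycle (Letter α)) | Wicks.IsPositive V}
  have hPC : Nat.card {x // (Quot.mk _ x : Wicks.Vertex (↑l : Cycle (Letter α))) ∈
      {V : Wicks.Vertex (↑l : Cycle (Letter α)) | Wicks.IsPositive V}} = _ :=
    Nat.card_congr (Equiv.subtypeEquivRight hpos)
  have hdesc' : 2 * Nat.card {x // l.idxOf (ι (ρ x)).1 < l.idxOf x.1} =
      Fintype.card {x // x ∈ (↑l : Cycle (Letter α))} + 2 := by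
    rw [Nat.card_eq_fintype_card, Fintype.card_subtype]
    exact hdesc
  have hsum : 3 * {V : Wicks.Vertex (↑l : Cycle (Letter α)) | Wicks.IsPositive V}.ncard +
      3 * Nat.card {x // l.idxOf (ι (ρ x)).1 < l.idxOf x.1} =
        2 * Fintype.card {x // x ∈ (↑l : Cycle (Letter α))} :=
    (congrArg (· + _) (hP.symm.trans hPC)).trans hcyc
  -- Three distinct positions satisfy exactly one of the two cyclic orders.
  have hN : {V : Wicks.Vertex (↑l : Cycle (Letter α)) | Wicks.IsNegative V} =
      {V | Wicks.IsPositive V}ᶜ := by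
    ext V
    induction V using Quot.inductionOn with
    | h x =>
      have n1 := hp.ne (h1 x)
      have n2 := hp.ne (h2 x)
      have n3 := hp.ne (h1 (ι (ρ x)))
      refine (hneg x).trans (Iff.trans ?_ (not_congr (hpos x)).symm)
      unfold CycLT
      omega
  have : Finite (Wicks.Vertex (↑l : Cycle (Letter α))) :=
    inferInstanceAs (Finite (Quot _))
  rw [hN, Set.ncard_compl]
  omega
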